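/- Let $K$ be a compact Hausdorff space, and let $C_p(K)$ denote the set of all continuous functions $K\to\mathbb{R}$ with the topology of pointwise convergence, i.e. the subspace topology inherited from the product $\mathbb{R}^K$. The following conditions are equivalent: (a) $K$ is scattered, i.e. no nonempty subset of $K$ is dense-in-itself (a set is dense-in-itself if it has no isolated points in its subspace topology); (b) $C_p(K)$ is Fréchet–Urysohn, i.e. whenever $A\subseteq C_p(K)$ and $f\in\overline{A}$, there is a sequence of elements of $A$ converging to $f$; (c) $C_p(K)$ does not have property (B). Here a topological space $X$ has property (B) if there are closed nowhere-dense sets $A_n\subseteq X$, $n\in\mathbb{N}$, with $X=\bigcup_{n} A_n$, such that every compact set $C\subseteq X$ is contained in $A_n$ for some $n$. -/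

import Mathlib

open Set Topology

/-- A topological space is scattered if no nonempty subset of it is dense-in-itself
(Mathlib's `Preperfect`: every point of the set is an accumulation point of the set). -/
def IsScatteredSpace (X : Type*) [TopologicalSpace X] : Prop :=
  ∀ A : Set X, A.Nonempty → ¬ Preperfect A

/-- `Cp X` is the set of continuous real-valued functions on `X` with the topology of pointwise
convergence, i.e. the subspace topology inherited from the product space `X → ℝ`. -/
abbrev Cp (X : Type*) [TopologicalSpace X] : Type _ :=
  {f : X → ℝ // Continuous f}

/-- Property (B): there is a countable cover by closed nowhere-dense sets such that every
compact set is contained in one member of the cover. -/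
def HasPropertyB (X : Type*) [TopologicalSpace X] : Prop :=
  ∃ A : ℕ → Set X,
    (∀ n, IsClosed (A n)) ∧ (∀ n, IsNowhereDense (A n)) ∧ (⋃ n, A n) = univ ∧
      ∀ C : Set X, IsCompact C → ∃ n, C ⊆ A n

/-! Scattered gives Fréchet–Urysohn: a point of a closure already lies in the closure of a countable
`B ⊆ A`, and evaluation on `B ∪ {f}` maps `K` onto a countable set, so approximating on longer and
longer finite parts of that set gives a sequence. Fréchet–Urysohn excludes (B): for a cover as in
(B), some convergent sequence eventually leaves every member, yet with its limit it is compact. If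
`K` is not scattered, take a Cantor scheme of perfect sets and a minimal closed `M` meeting all of
them (`exists_isClosed_meeting_family`). Baire category on `M` bounds each compact set of functions
uniformly on the trace of some scheme member, and these traces are infinite, so the functions
bounded by `n` on a given trace form the cover. -/

/-- In a compact space, among the closed sets meeting every member of a family of closed sets there
is a minimal one; every relatively open nonempty part of it contains the trace of some member. -/
theorem exists_isClosed_meeting_family {K ι : Type*} [TopologicalSpace K] [CompactSpace K]
    (F : ι → Set K) (hF : ∀ i, IsClosed (F i)) (hne : ∀ i, (F i).Nonempty) :
    ∃ M : Set K, IsClosed M ∧ (∀ i, (F i ∩ M).Nonempty) ∧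
      ∀ V : Set K, IsOpen V → (V ∩ M).Nonempty → ∃ i, F i ∩ M ⊆ V := by
  obtain ⟨M, hM⟩ := zorn_superset {N : Set K | IsClosed N ∧ ∀ i, (F i ∩ N).Nonempty} (by
    intro c hc hchain
    rcases c.eq_empty_or_nonempty with rfl | hcne
    · exact ⟨univ, ⟨isClosed_univ, by simpa using hne⟩, by simp⟩
    · refine ⟨⋂₀ c, ⟨isClosed_sInter fun N hN => (hc hN).1, fun i => ?_⟩,
        fun s hs => sInter_subset_of_mem hs⟩
      have : Nonempty c := hcne.to_subtype
      have h := IsCompact.nonempty_iInter_of_directed_nonempty_isCompact_isClosed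
        (fun N : c => F i ∩ N.1) (by
          intro N₁ N₂
          rcases hchain.total N₁.2 N₂.2 with h | h
          · exact ⟨N₁, Subset.rfl, inter_subset_inter_right _ h⟩
          · exact ⟨N₂, inter_subset_inter_right _ h, Subset.rfl⟩)
        (fun N => (hc N.2).2 i) (fun N => ((hF i).inter (hc N.2).1).isCompact)
        (fun N => (hF i).inter (hc N.2).1)
      rwa [← inter_iInter, ← sInter_eq_iInter] at h)
  refine ⟨M, hM.prop.1, hM.prop.2, fun V hV hVM => ?_⟩
  by_contra! hcon
  have hmem : M \ V ∈ {N : Set K | IsClosed N ∧ ∀ i, (F i ∩ N).Nonempty} := by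
    refine ⟨hM.prop.1.sdiff hV, fun i => ?_⟩
    obtain ⟨x, hx, hxV⟩ := not_subset.mp (hcon i)
    exact ⟨x, hx.1, hx.2, hxV⟩
  obtain ⟨x, hxV, hxM⟩ := hVM
  exact (hM.le_of_le hmem sdiff_subset hxM).2 hxV

/-- A continuous image of a compact scattered space in a second countable Hausdorff space is
countable. -/
theorem IsScatteredSpace.countable_range {K Y : Type*} [TopologicalSpace K] [CompactSpace K]
    [TopologicalSpace Y] [T2Space Y] [SecondCountableTopology Y] (hK : IsScatteredSpace K)
    {φ : K → Y} (hφ : Continuous φ) : (range φ).Countable := by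
  by_contra hunc
  obtain ⟨P, hP, ⟨p, hp⟩, hPr⟩ :=
    exists_perfect_nonempty_of_isClosed_of_not_countable (isCompact_range hφ).isClosed hunc
  obtain ⟨M, hMc, hM, hmin⟩ := exists_isClosed_meeting_family (fun y : P => φ ⁻¹' {y.1})
    (fun y => isClosed_singleton.preimage hφ) (fun y => hPr y.2)
  obtain ⟨x₀, -, hx₀⟩ := hM ⟨p, hp⟩
  refine hK M ⟨x₀, hx₀⟩ (preperfect_iff_nhds.mpr fun x hx U hU => ?_)
  by_contra! hiso
  obtain ⟨V, hVU, hV, hxV⟩ := mem_nhds_iff.mp hU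
  obtain ⟨y, hy⟩ := hmin V hV ⟨x, hxV, hx⟩
  have hcl : IsClosed (φ '' (M \ V)) := (hMc.sdiff hV).isCompact.image hφ |>.isClosed
  -- If `x` were isolated in `M`, the fibre of `M` over `y` would be `{x}`, so the compact image of
  -- the rest would contain `P \ {y}` but not its limit point `y`.
  have hsub : P \ {y.1} ⊆ φ '' (M \ V) := by
    rintro z ⟨hzP, hzy⟩
    obtain ⟨w, hw, hwM⟩ := hM ⟨z, hzP⟩
    refine ⟨w, ⟨hwM, fun hwV => hzy ?_⟩, hw⟩
    obtain ⟨v, hv, hvM⟩ := hM y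
    have h1 := hiso w ⟨hVU hwV, hwM⟩
    have h2 := hiso v ⟨hVU (hy ⟨hv, hvM⟩), hvM⟩
    have hw' : φ w = z := hw
    have hv' : φ v = y.1 := hv
    rw [mem_singleton_iff, ← hw', ← hv', h1, h2]
  have hycl : y.1 ∈ closure (P \ {y.1}) :=
    mem_closure_iff_clusterPt.mpr (accPt_principal_iff_clusterPt.mp (hP.acc y.1 y.2))
  obtain ⟨w, ⟨hwM, hwV⟩, hw⟩ := hcl.closure_subset_iff.mpr hsub hycl
  exact hwV (hy ⟨hw, hwM⟩)

theorem Cp.continuous_eval {X : Type*} [TopologicalSpace X] (x : X) :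
    Continuous fun f : Cp X => f.1 x :=
  (continuous_apply x).comp continuous_subtype_val

/-- A function lies in the pointwise closure of `A` iff members of `A` approximate it uniformly on
every finite set. -/
theorem Cp.mem_closure_iff {X : Type*} [TopologicalSpace X] {A : Set (Cp X)} {f : Cp X} :
    f ∈ closure A ↔
      ∀ E : Set X, E.Finite → ∀ ε > 0, ∃ g ∈ A, ∀ x ∈ E, |g.1 x - f.1 x| < ε := by
  constructor
  · intro hf E hE ε hε
    have hev : ∀ᶠ g : Cp X in 𝓝 f, ∀ x ∈ E, |g.1 x - f.1 x| < ε := by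
      refine (Filter.eventually_all_finite hE).mpr fun x _ => ?_
      have hc : Continuous fun g : Cp X => |g.1 x - f.1 x| :=
        ((Cp.continuous_eval x).sub continuous_const).abs
      exact hc.continuousAt.eventually_lt_const (by simpa using hε)
    obtain ⟨g, hg, hgA⟩ := ((mem_closure_iff_frequently.mp hf).and_eventually hev).exists
    exact ⟨g, hg, hgA⟩
  · intro h
    rw [closure_subtype, mem_closure_iff_nhds]
    intro U hU
    rw [nhds_pi, Filter.mem_pi] at hU
    obtain ⟨E, hE, t, ht, htU⟩ := hU
    have hball : ∀ x, ∃ ε > 0, Metric.ball (f.1 x) ε ⊆ t x := fun x => Metric.mem_nhds_iff.mp (ht x)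
    choose ε hε hball using hball
    obtain ⟨δ, hδ, hδE⟩ : ∃ δ > 0, ∀ x ∈ E, δ ≤ ε x := by
      rcases E.eq_empty_or_nonempty with rfl | hne
      · exact ⟨1, one_pos, by simp⟩
      · obtain ⟨x, -, hx⟩ := exists_min_image E ε hE hne
        exact ⟨ε x, hε x, hx⟩
    obtain ⟨g, hg, hgE⟩ := h E hE δ hδ
    refine ⟨g.1, htU fun x hx => hball x ?_, mem_image_of_mem _ hg⟩
    rw [Metric.mem_ball, Real.dist_eq]
    exact (hgE x hx).trans_le (hδE x hx)

theorem Cp.tendsto_iff {X α : Type*} [TopologicalSpace X] {l : Filter α} {u : α → Cp X}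
    {f : Cp X} : Filter.Tendsto u l (𝓝 f) ↔ ∀ x, Filter.Tendsto (fun a => (u a).1 x) l (𝓝 (f.1 x)) := by
  rw [tendsto_subtype_rng, tendsto_pi_nhds]

/-- Countable tightness of the space of continuous functions on a compact space. -/
theorem Cp.exists_countable_mem_closure {K : Type*} [TopologicalSpace K] [CompactSpace K]
    {A : Set (Cp K)} {f : Cp K} (hf : f ∈ closure A) :
    ∃ B ⊆ A, B.Countable ∧ f ∈ closure B := by
  have key : ∀ n : ℕ, ∃ B ⊆ A, B.Finite ∧
      ∀ x : Fin n → K, ∃ g ∈ B, ∀ i, |g.1 (x i) - f.1 (x i)| < 1 / ((n : ℝ) + 1) := by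
    intro n
    let W : A → Set (Fin n → K) := fun g =>
      {x | ∀ i, |g.1.1 (x i) - f.1 (x i)| < 1 / ((n : ℝ) + 1)}
    have hW : ∀ g, IsOpen (W g) := by
      intro g
      have hg := g.1.2
      have hf' := f.2
      simp only [W, ofPred_forall]
      exact isOpen_iInter_of_finite fun i => isOpen_lt (by fun_prop) continuous_const
    obtain ⟨t, ht⟩ := isCompact_univ.elim_finite_subcover W hW (by
      intro x _
      obtain ⟨g, hg, hgx⟩ := Cp.mem_closure_iff.mp hf (range x) (finite_range x)
        (1 / ((n : ℝ) + 1)) (by positivity)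
      exact mem_iUnion.mpr ⟨⟨g, hg⟩, fun i => hgx _ (mem_range_self i)⟩)
    refine ⟨Subtype.val '' (t : Set A), by simp, t.finite_toSet.image _, fun x => ?_⟩
    obtain ⟨g, hg, hx⟩ := mem_iUnion₂.mp (ht (mem_univ x))
    exact ⟨g.1, mem_image_of_mem _ hg, hx⟩
  choose B hBA hBf hB using key
  refine ⟨⋃ n, B n, iUnion_subset hBA, countable_iUnion fun n => (hBf n).countable, ?_⟩
  refine Cp.mem_closure_iff.mpr fun E hE ε hε => ?_
  obtain ⟨m, hm⟩ := exists_nat_one_div_lt hε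
  rcases E.eq_empty_or_nonempty with rfl | hne
  · obtain ⟨g, hg, -⟩ := hB 0 Fin.elim0
    exact ⟨g, mem_iUnion.mpr ⟨0, hg⟩, by simp⟩
  · obtain ⟨u, hu⟩ := hE.countable.exists_eq_range hne
    obtain ⟨k, hk⟩ := (hE.image (Function.invFun u)).bddAbove
    -- `m` controls the error; `k + 1` leaves a slot for every index of a point of `E`.
    obtain ⟨g, hg, hgu⟩ := hB (max m (k + 1)) fun i => u i
    refine ⟨g, mem_iUnion.mpr ⟨_, hg⟩, fun x hx => ?_⟩
    have hi : Function.invFun u x ≤ k := hk (mem_image_of_mem _ hx)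
    have hux : u (Function.invFun u x) = x := Function.invFun_eq (hu ▸ hx : x ∈ range u)
    have hlt := hgu ⟨Function.invFun u x, lt_max_of_lt_right (Nat.lt_succ_of_le hi)⟩
    simp only [hux] at hlt
    refine hlt.trans (lt_of_le_of_lt ?_ hm)
    gcongr
    exact le_max_left _ _

theorem IsScatteredSpace.frechetUrysohnSpace_cp {K : Type*} [TopologicalSpace K] [CompactSpace K]
    (hK : IsScatteredSpace K) : FrechetUrysohnSpace (Cp K) := by
  refine ⟨fun A f hf => ?_⟩
  obtain ⟨B, hBA, hBc, hfB⟩ := Cp.exists_countable_mem_closure hf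
  -- Including `f` makes points with equal image indistinguishable for the limit as well.
  have := (hBc.insert f).to_subtype
  let φ : K → (↥(insert f B) → ℝ) := fun x g => g.1.1 x
  have hφ : Continuous φ := continuous_pi fun g => g.1.2
  obtain ⟨g₀, hg₀, -⟩ := Cp.mem_closure_iff.mp hfB ∅ finite_empty 1 one_pos
  rcases isEmpty_or_nonempty K with hKe | hKne
  · exact ⟨fun _ => g₀, fun _ => hBA hg₀, Cp.tendsto_iff.mpr fun x => (hKe.false x).elim⟩
  obtain ⟨y, hy⟩ := (hK.countable_range hφ).exists_eq_range (range_nonempty φ)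
  have hx : ∀ n, ∃ x, φ x = y n := fun n => by
    have : y n ∈ range φ := hy ▸ mem_range_self n
    exact this
  choose x hx using hx
  have hg : ∀ n : ℕ, ∃ g ∈ B, ∀ z ∈ x '' Iic n, |g.1 z - f.1 z| < 1 / ((n : ℝ) + 1) := fun n =>
    Cp.mem_closure_iff.mp hfB _ ((finite_Iic n).image x) _ (by positivity)
  choose g hgB hg using hg
  refine ⟨g, fun n => hBA (hgB n), Cp.tendsto_iff.mpr fun z => ?_⟩
  obtain ⟨m, hm⟩ : φ z ∈ range y := hy ▸ mem_range_self z
  have hz : ∀ h ∈ insert f B, h.1 z = h.1 (x m) := fun h hh =>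
    congrFun (hm.symm.trans (hx m).symm) ⟨h, hh⟩
  refine tendsto_iff_dist_tendsto_zero.mpr (squeeze_zero' (.of_forall fun _ => dist_nonneg) ?_
    tendsto_one_div_add_atTop_nhds_zero_nat)
  filter_upwards [Filter.eventually_ge_atTop m] with n hn
  rw [Real.dist_eq, hz _ (mem_insert_of_mem _ (hgB n)), hz f (mem_insert _ _)]
  exact (hg n (x m) ⟨m, hn, rfl⟩).le

/-- In a Fréchet–Urysohn space of continuous functions no cover witnesses property (B). -/
theorem not_hasPropertyB_of_frechetUrysohnSpace {X : Type*} [TopologicalSpace X]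
    [FrechetUrysohnSpace (Cp X)] : ¬ HasPropertyB (Cp X) := by
  rintro ⟨A, hAc, hAn, hAu, hAk⟩
  let D : ℕ → Set (Cp X) := accumulate A
  have hA : ∀ n, IsOpen (A n)ᶜ ∧ Dense (A n)ᶜ := fun n =>
    isClosed_isNowhereDense_iff_compl.mp ⟨hAc n, hAn n⟩
  have hD : ∀ n, Dense (D n)ᶜ := by
    intro n
    induction n with
    | zero => simpa [D] using (hA 0).2
    | succ n ih =>
      simp only [D, accumulate_succ, compl_union]
      exact ih.inter_of_isOpen_right (hA (n + 1)).2 (hA (n + 1)).1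
  have hmono : ∀ {m n}, m ≤ n → A m ⊆ D n := fun {m n} h =>
    subset_accumulate.trans (monotone_accumulate h)
  let c : ℝ → Cp X := fun r => ⟨fun _ => r, continuous_const⟩
  rcases isEmpty_or_nonempty X with hX | ⟨⟨p⟩⟩
  · obtain ⟨n, hn⟩ := mem_iUnion.mp (hAu ▸ mem_univ (c 0))
    obtain ⟨h, hh⟩ := (hD n).nonempty_iff.mpr ⟨c 0⟩
    exact hh (hmono le_rfl ((Subtype.ext (funext fun x => (hX.false x).elim) : c 0 = h) ▸ hn))
  -- The bound `1 / (n + 2)` lies strictly below the constant `1 / (n + 1)`, which keeps that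
  -- constant in the closure, and forces `n → ∞` along any sequence in `S` tending to `0`.
  let S : Set (Cp X) := {g | ∃ n : ℕ, g ∉ D n ∧ 1 / ((n : ℝ) + 2) < g.1 p}
  have hcS : ∀ n : ℕ, c (1 / ((n : ℝ) + 1)) ∈ closure S := by
    intro n
    have hopen : IsOpen {g : Cp X | 1 / ((n : ℝ) + 2) < g.1 p} :=
      isOpen_lt continuous_const (Cp.continuous_eval p)
    have hmem : c (1 / ((n : ℝ) + 1)) ∈ {g : Cp X | 1 / ((n : ℝ) + 2) < g.1 p} := by
      have : (1 : ℝ) / (n + 2) < 1 / (n + 1) :=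
        one_div_lt_one_div_of_lt (by positivity) (by linarith)
      exact this
    have hsub : {g : Cp X | 1 / ((n : ℝ) + 2) < g.1 p} ∩ (D n)ᶜ ⊆ S :=
      fun g hg => ⟨n, hg.2, hg.1⟩
    exact closure_mono hsub ((hD n).open_subset_closure_inter hopen hmem)
  have h0 : c 0 ∈ closure S := by
    refine isClosed_closure.mem_of_tendsto (f := fun n : ℕ => c (1 / ((n : ℝ) + 1)))
      (Cp.tendsto_iff.mpr fun _ => tendsto_one_div_add_atTop_nhds_zero_nat) (.of_forall hcS)
  obtain ⟨g, hgS, hg⟩ := FrechetUrysohnSpace.closure_subset_seqClosure S h0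
  choose N hN hgN using hgS
  obtain ⟨m, hm⟩ := hAk _ hg.isCompact_insert_range
  have hp := Cp.tendsto_iff.mp hg p
  obtain ⟨k, hk⟩ := (hp.eventually_lt_const (show (0 : ℝ) < 1 / ((m : ℝ) + 2) by positivity)).exists
  have hmN : m ≤ N k := by
    by_contra! hlt
    have : (1 : ℝ) / (m + 2) ≤ 1 / (N k + 2) := by gcongr
    linarith [hgN k]
  exact hN k (hmono hmN (hm (mem_insert_of_mem _ (mem_range_self k))))

/-- A family of sets in which every member contains two disjoint members, all nonempty, consists of
infinite sets. -/
theorem infinite_of_splitting {K ι : Type*} (G : ι → Set K) (hne : ∀ i, (G i).Nonempty)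
    (hsplit : ∀ i, ∃ j k, G j ⊆ G i ∧ G k ⊆ G i ∧ Disjoint (G j) (G k)) (i : ι) :
    (G i).Infinite := by
  suffices h : ∀ n, ∀ i, (G i).Finite → (G i).ncard = n → False from
    fun hi => h _ i hi rfl
  intro n
  induction n using Nat.strong_induction_on with
  | _ n ih =>
    rintro i hi rfl
    obtain ⟨j, k, hj, hk, hd⟩ := hsplit i
    refine ih (G j).ncard (ncard_lt_ncard ⟨hj, fun h => ?_⟩ hi) j (hi.subset hj) rfl
    obtain ⟨x, hx⟩ := hne k
    exact hd.notMem_of_mem_left (h (hk hx)) hx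

theorem Cp.isClosed_bounded {X : Type*} [TopologicalSpace X] (D : Set X) (r : ℝ) :
    IsClosed {f : Cp X | ∀ x ∈ D, |f.1 x| ≤ r} := by
  simp only [ofPred_forall]
  exact isClosed_biInter fun x _ => isClosed_le (Cp.continuous_eval x).abs continuous_const

/-- Functions bounded by a fixed constant on an infinite set form a nowhere dense set. -/
theorem Cp.isNowhereDense_bounded {K : Type*} [TopologicalSpace K] [NormalSpace K] [T1Space K]
    {D : Set K} (hD : D.Infinite) (r : ℝ) :
    IsNowhereDense {f : Cp K | ∀ x ∈ D, |f.1 x| ≤ r} := by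
  rw [(Cp.isClosed_bounded D r).isNowhereDense_iff, interior_eq_empty_iff_dense_compl]
  intro f
  refine Cp.mem_closure_iff.mpr fun E hE ε hε => ?_
  obtain ⟨d, hdD, hdE⟩ := hD.exists_notMem_finite hE
  obtain ⟨h, h0, h1, -⟩ := exists_continuous_zero_one_of_isClosed hE.isClosed
    (isClosed_singleton (x := d)) (disjoint_singleton_right.mpr hdE)
  -- A bump vanishing on `E` raises the value at `d` to `r + 1`.
  refine ⟨⟨fun x => f.1 x + (r + 1 - f.1 d) * h x, by have := f.2; fun_prop⟩, fun hg => ?_,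
    fun x hx => by simpa [h0 hx] using hε⟩
  have := hg d hdD
  simp only [h1 (mem_singleton d), Pi.one_apply] at this
  linarith [le_abs_self (f.1 d + (r + 1 - f.1 d) * 1)]

theorem hasPropertyB_of_not_isScatteredSpace {K : Type*} [TopologicalSpace K] [CompactSpace K]
    [T2Space K] (hK : ¬ IsScatteredSpace K) : HasPropertyB (Cp K) := by
  simp only [IsScatteredSpace, not_forall, not_not] at hK
  obtain ⟨P, hPne, hP⟩ := hK
  let T := {C : Set K // Perfect C ∧ C.Nonempty}
  have hsplit : ∀ C : T, ∃ C' : Bool → T, (∀ b, (C' b).1 ⊆ C.1) ∧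
      Disjoint (C' false).1 (C' true).1 := by
    rintro ⟨C, hC, hCne⟩
    obtain ⟨C₀, C₁, ⟨h0, hn0, hs0⟩, ⟨h1, hn1, hs1⟩, hd⟩ := hC.splitting hCne
    exact ⟨fun b => b.rec ⟨C₀, h0, hn0⟩ ⟨C₁, h1, hn1⟩, fun b => by cases b <;> assumption, hd⟩
  choose next hnext hdisj using hsplit
  let root : T := ⟨closure P, hP.perfect_closure, hPne.closure⟩
  -- `b :: s` indexes a child of `s`.
  let F : List Bool → T := List.foldr (fun b C => next C b) root
  obtain ⟨M, hMc, hM, hmin⟩ := exists_isClosed_meeting_family (fun s => (F s).1)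
    (fun s => (F s).2.1.closed) (fun s => (F s).2.2)
  have hinf : ∀ s, ((F s).1 ∩ M).Infinite := infinite_of_splitting _ hM fun s =>
    ⟨false :: s, true :: s, inter_subset_inter_left _ (hnext _ _),
      inter_subset_inter_left _ (hnext _ _),
      (hdisj (F s)).mono inter_subset_left inter_subset_left⟩
  have hcompact : ∀ C : Set (Cp K), IsCompact C →
      ∃ q : List Bool × ℕ, C ⊆ {f | ∀ x ∈ (F q.1).1 ∩ M, |f.1 x| ≤ q.2} := by
    intro C hC
    have : CompactSpace M := isCompact_iff_compactSpace.mp hMc.isCompact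
    have : Nonempty M := (hM []).mono inter_subset_right |>.to_subtype
    let Z : ℕ → Set M := fun n => {x | ∀ f ∈ C, |f.1 x.1| ≤ n}
    have hZ : ∀ n, IsClosed (Z n) := fun n => by
      simp only [Z, ofPred_forall]
      refine isClosed_biInter fun f _ => isClosed_le ?_ continuous_const
      have := f.2
      fun_prop
    have hZu : ⋃ n, Z n = univ := by
      refine eq_univ_of_forall fun x => ?_
      have hcont : Continuous fun f : Cp K => |f.1 x.1| := (Cp.continuous_eval x.1).abs
      obtain ⟨r, hr⟩ := (hC.image hcont).bddAbove
      obtain ⟨n, hn⟩ := exists_nat_ge r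
      exact mem_iUnion.mpr ⟨n, fun f hf => (hr (mem_image_of_mem _ hf)).trans hn⟩
    -- Baire category gives a bound on a relatively open part of `M`; minimality of `M` puts a whole
    -- trace inside it.
    obtain ⟨n, x, hx⟩ := nonempty_interior_of_iUnion_of_closed hZ hZu
    obtain ⟨V', hV'Z, hV', hxV'⟩ := mem_interior.mp hx
    obtain ⟨V, hV, rfl⟩ := isOpen_induced_iff.mp hV'
    obtain ⟨s, hs⟩ := hmin V hV ⟨x, hxV', x.2⟩
    exact ⟨(s, n), fun f hf y hy => hV'Z (show (⟨y, hy.2⟩ : M) ∈ _ from hs hy) f hf⟩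
  obtain ⟨e, he⟩ := exists_surjective_nat (List Bool × ℕ)
  refine ⟨fun n => {f | ∀ x ∈ (F (e n).1).1 ∩ M, |f.1 x| ≤ (e n).2},
    fun n => Cp.isClosed_bounded _ _, fun n => Cp.isNowhereDense_bounded (hinf _) _, ?_, ?_⟩
  · refine eq_univ_of_forall fun f => ?_
    obtain ⟨q, hq⟩ := hcompact {f} isCompact_singleton
    obtain ⟨n, rfl⟩ := he q
    exact mem_iUnion.mpr ⟨n, hq rfl⟩
  · intro C hC
    obtain ⟨q, hq⟩ := hcompact C hC
    obtain ⟨n, rfl⟩ := he q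
    exact ⟨n, hq⟩

theorem mainTheorem6 (K : Type*) [TopologicalSpace K] [CompactSpace K] [T2Space K] :
    List.TFAE
      [IsScatteredSpace K,
       FrechetUrysohnSpace (Cp K),
       ¬ HasPropertyB (Cp K)] := by
  tfae_have 1 → 2 := fun h => h.frechetUrysohnSpace_cp
  tfae_have 2 → 3 := fun _ => not_hasPropertyB_of_frechetUrysohnSpace
  tfae_have 3 → 1 := fun h => by_contra fun h' => h (hasPropertyB_of_not_isScatteredSpace h')
  tfae_finish
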